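/- Let $\mathcal M$ be a transversal matroid of rank $r$ on $[n]$ with a presentation $(A_1,\dots,A_r)$: its bases are the sets of elements of $[n]$ covered by the matchings of maximum size in the bipartite graph with edges $(x,j)$, $x\in A_j$. The type of $x\in[n]$ is $\phi(x)=\{j: x\in A_j\}$, and $l_{I}=l_{\mathcal M,I}$ is the number of $x$ of type $I\subseteq[r]$. Order the subsets of $[r]$ by $I\prec I'$ if $|I|<|I'|$, or $|I|=|I'|$ and $I$ is lexicographically smaller; let $I_1\prec\dots\prec I_m$ be the types with $l_{I_i}>0$. For $J\subseteq\{0,1,\dots,r\}$ let $\Delta_J\subset\mathbb R^r$ be the convex hull of the $e_j$, $j\in J$, where $e_0=0$. The transversalhedron is $P_{\mathcal M}=\sum_{I\subseteq[r]} l_I\Delta_{\{0\}\cup I}$. For a sequence $a=(a_1,\dots,a_m)$ let $\mathcal I^a$ be the multiset in which each $I_i$ occurs $a_i$ times; a multiset of subsets of $[r]$ is maximal valid if it has $r$ members and the union of any $t$ of its members has at least $t$ elements. $EP_{\mathcal M}(\mathcal I^a)$ is the set of $I\subseteq[r]$ for which there is $I'\subseteq[r]$ with $I\prec I'$ such that $(\mathcal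 I^a\setminus\{I'\})\cup\{I\}$ (one occurrence of $I'$ removed) is maximal valid. The canonical subdivision of $P_{\mathcal M}$ is the following set of cells $\sum_i l_{I_i}\Delta_{J_i}$. Suppose first that $l_{\{j\}}\ge1$ for all $j\in[r]$. Start with the single cell in which $J_I=\{0\}\cup I$ for the types $I$ with $|I|\le1$. Treat the occurring types with at least two elements in increasing order. For such a type $I_k$ let $P'=\sum_{I\prec I_k}l_I\Delta_{\{0\}\cup I}$, which is already subdivided. The faces of a cell $\sum_I l_I\Delta_{J_I}$ are the sums $\sum_I l_I\Delta_{F_I}$ with $\emptyset\ne F_I\subseteq J_I$; the nontrivial boundary of $P'$ is the part of $P'$ on the hyperplanes $\sum_{j\in H}x_j=\sum_{I\prec I_k,\,I\cap H\ne\emptyset}l_I$ with $\emptyset\neq H\subseteq[r]$, and a face is said to lie on it if it is contained in one of these hyperplanes. A facet $K$ of a cell that lies on the nontrivial boundary is free in direction $j$ if $x+\varepsilon e_j\notin P'$ for all $x\in K$ and $\varepsilon>0$; it is labeled with the least $t\in I_k$ in whose direction it is free (if there is one). A face $F$ of a cell that lies on the nontrivial boundary is labeled with the set $T$ of the labels of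 those facets of cells on the nontrivial boundary that contain $F$, and is saturated if $|T|$ is the codimension of $F$ in $\mathbb R^r$. Keep all old cells, with $J_{I_k}=\{0\}$, and add the cell $F+l_{I_k}\Delta_{\{0\}\cup T}$ for each saturated face $F$ with label $T$. If some singleton types $\{j\}$ do not occur, add one element of each of these types, take the cells of the resulting canonical subdivision that lie in the region $x_j\ge1$ for all these $j$, and drop the summands of the added types. The type of a cell $\sum_i l_{I_i}\Delta_{J_i}$ is $\mathcal I^a$ with $a_i=|J_i|-1$. Lemma. For every cell $l_{I_1}\Delta_{J_1}+\dots+l_{I_m}\Delta_{J_m}$ of the canonical subdivision of $P_{\mathcal M}$, with type $\mathcal I^a$, and every $i$: $0\notin J_i$ if and only if $I_i\in EP_{\mathcal M}(\mathcal I^a)$. -/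

import Mathlib

open scoped Pointwise

namespace Transversalhedron

/-! ### Transversal matroids and types -/

/-- A matching of the bipartite graph of the family `A`, whose edges are the pairs `(x, j)` with
`x ∈ A j`, given as a finite set of edges no two of which share an endpoint. -/
def IsMatching {n r : ℕ} (A : Fin r → Finset (Fin n)) (T : Finset (Fin n × Fin r)) : Prop :=
  (∀ e ∈ T, e.1 ∈ A e.2) ∧
    ∀ e ∈ T, ∀ e' ∈ T, (e.1 = e'.1 ∨ e.2 = e'.2) → e = e'

/-- `A` is a presentation of the matroid `M` on `[n]`: the bases of `M` are the sets of left
endpoints of the matchings of maximum size. -/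
def IsPresentation {n r : ℕ} (M : Matroid (Fin n)) (A : Fin r → Finset (Fin n)) : Prop :=
  M.E = Set.univ ∧
    ∀ B : Finset (Fin n), M.IsBase (B : Set (Fin n)) ↔
      ∃ T, IsMatching A T ∧ (∀ T', IsMatching A T' → T'.card ≤ T.card) ∧ T.image Prod.fst = B

/-- The type `φ(x)` of an element `x` of the ground set. -/
def elemType {n r : ℕ} (A : Fin r → Finset (Fin n)) (x : Fin n) : Finset (Fin r) :=
  Finset.univ.filter fun j => x ∈ A j

/-- The number `l_{M,I}` of elements of type `I`. -/
def mult {n r : ℕ} (A : Fin r → Finset (Fin n)) (I : Finset (Fin r)) : ℕ :=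
  (Finset.univ.filter fun x => elemType A x = I).card

/-- Sort key for the order on subsets of `[r]`: first by cardinality, then lexicographically
(on the increasing lists of elements). -/
def precKey {r : ℕ} (I : Finset (Fin r)) : ℕ ×ₗ List (Fin r) :=
  toLex (I.card, I.sort (· ≤ ·))

/-- The strict total order `I ≺ I'` on subsets of `[r]`. -/
def Prec {r : ℕ} (I I' : Finset (Fin r)) : Prop := precKey I < precKey I'

/-- The weak version `I ⪯ I'` of the order. -/
def PrecEq {r : ℕ} (I I' : Finset (Fin r)) : Prop := precKey I ≤ precKey I'

instance {r : ℕ} : DecidableRel (Prec (r := r)) := fun I I' =>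
  inferInstanceAs (Decidable (precKey I < precKey I'))

instance {r : ℕ} : DecidableRel (PrecEq (r := r)) := fun I I' =>
  inferInstanceAs (Decidable (precKey I ≤ precKey I'))

theorem precKey_injective {r : ℕ} : Function.Injective (precKey (r := r)) := by
  intro I I' h
  have h2 : I.sort (· ≤ ·) = I'.sort (· ≤ ·) := congrArg (fun p => (ofLex p).2) h
  rw [← Finset.sort_toFinset I (· ≤ ·), h2, Finset.sort_toFinset]

instance {r : ℕ} : IsTrans (Finset (Fin r)) PrecEq := ⟨fun _ _ _ h h' => le_trans h h'⟩

instance {r : ℕ} : Std.Antisymm (PrecEq (r := r)) :=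
  ⟨fun _ _ h h' => precKey_injective (le_antisymm h h')⟩

instance {r : ℕ} : Std.Total (PrecEq (r := r)) := ⟨fun _ _ => le_total _ _⟩

/-- The collection `𝓘^a`, in which each `I` occurs `a I` times. -/
def collection {r : ℕ} (a : Finset (Fin r) → ℕ) : Multiset (Finset (Fin r)) :=
  ∑ I, Multiset.replicate (a I) I

/-- Hall's condition: the union of any `t` sets of the collection has at least `t` elements. -/
def IsValid {r : ℕ} (τ : Multiset (Finset (Fin r))) : Prop :=
  ∀ s ≤ τ, Multiset.card s ≤ s.sup.card

/-- A maximal valid collection: it satisfies Hall's condition and has `r` members. -/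
def IsMaximalValid {r : ℕ} (τ : Multiset (Finset (Fin r))) : Prop :=
  IsValid τ ∧ Multiset.card τ = r

/-- The set `EP(τ)` of the `I ⊆ [r]` that may replace one occurrence of some `I' ≻ I` in `τ` so
that the result is again a maximal valid collection. (If `I'` does not occur in `τ`, nothing is
removed and, for a maximal `τ`, the result is too large to be maximal.) -/
def EP {r : ℕ} (τ : Multiset (Finset (Fin r))) : Set (Finset (Fin r)) :=
  {I | ∃ I', Prec I I' ∧ IsMaximalValid (I ::ₘ τ.erase I')}

/-! ### Transversalhedra and Minkowski faces

The label set `{0, 1, …, r}` is `Fin (r + 1)`; the element `j` of `[r]`, modelled by `Fin r`,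
is the label `j.succ`. -/

/-- The set of labels `{0} ∪ T`, for `T ⊆ [r]`. -/
def withZero {r : ℕ} (T : Finset (Fin r)) : Finset (Fin (r + 1)) :=
  insert 0 (T.map (Fin.succEmb r))

/-- The point of `ℝ^r` with a given label: the origin for `0`, the basis vector `e_j` for `j`. -/
def vert {r : ℕ} : Fin (r + 1) → (Fin r → ℝ) :=
  Fin.cases 0 fun j => Pi.single j 1

/-- The simplex `Δ_J`, for `J ⊆ {0, …, r}`. -/
def simplex {r : ℕ} (J : Finset (Fin (r + 1))) : Set (Fin r → ℝ) :=
  convexHull ℝ (vert '' (J : Set (Fin (r + 1))))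

/-- The Minkowski sum `∑_I l_I Δ_{J_I}`. All families `J` in use have `J I = {0}` whenever
`l I = 0`. -/
def minkowskiSum {r : ℕ} (l : Finset (Fin r) → ℕ) (J : Finset (Fin r) → Finset (Fin (r + 1))) :
    Set (Fin r → ℝ) :=
  ∑ I, (l I : ℝ) • simplex (J I)

/-- The transversalhedron `∑_I l_I Δ_{{0} ∪ I}`. -/
def transversalhedron {r : ℕ} (l : Finset (Fin r) → ℕ) : Set (Fin r → ℝ) :=
  minkowskiSum l withZero

/-- The dimension of a set: the dimension of its affine span. -/
noncomputable def dim {r : ℕ} (S : Set (Fin r → ℝ)) : ℕ :=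
  Module.finrank ℝ (vectorSpan ℝ S)

/-- The family `F` describes a Minkowski face of a cell from `𝒟`. The faces of a fine cell
`∑_I l_I Δ_{J_I}` are the sums `∑_I l_I Δ_{F_I}` with `∅ ≠ F_I ⊆ J_I`. -/
def IsMinkowskiFace {r : ℕ} (𝒟 : Set (Finset (Fin r) → Finset (Fin (r + 1))))
    (F : Finset (Fin r) → Finset (Fin (r + 1))) : Prop :=
  ∃ J ∈ 𝒟, ∀ I, (F I).Nonempty ∧ F I ⊆ J I

/-- `S` lies on the nontrivial boundary of the transversalhedron of `l`, that is, on one of the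
hyperplanes `x_H = ∑_{I ∩ H ≠ ∅} l_I`. -/
def OnNontrivialBoundary {r : ℕ} (l : Finset (Fin r) → ℕ) (S : Set (Fin r → ℝ)) : Prop :=
  ∃ H : Finset (Fin r), H.Nonempty ∧
    ∀ x ∈ S, ∑ j ∈ H, x j = ∑ I with (I ∩ H).Nonempty, (l I : ℝ)

/-- The set of directions in which `S` is free: moving from any point of `S` in the positive
direction of the axis `j` leaves the transversalhedron of `l`. -/
def freeDirections {r : ℕ} (l : Finset (Fin r) → ℕ) (S : Set (Fin r → ℝ)) : Set (Fin r) :=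
  {j | ∀ x ∈ S, ∀ ε : ℝ, 0 < ε → x + ε • Pi.single j 1 ∉ transversalhedron l}

/-- The label of a Minkowski face `F` on the nontrivial boundary, with respect to the next type
`I₀`: the set of those `t` for which some Minkowski facet `K` on the nontrivial boundary contains
`F` and has `t` as the least element of `I₀` in which it is free. -/
def faceLabel {r : ℕ} (l : Finset (Fin r) → ℕ)
    (𝒟 : Set (Finset (Fin r) → Finset (Fin (r + 1)))) (I₀ : Finset (Fin r))
    (F : Finset (Fin r) → Finset (Fin (r + 1))) : Set (Fin r) :=
  {t | ∃ K, IsMinkowskiFace 𝒟 K ∧ dim (minkowskiSum l K) + 1 = r ∧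
      OnNontrivialBoundary l (minkowskiSum l K) ∧
      minkowskiSum l F ⊆ minkowskiSum l K ∧
      IsLeast (freeDirections l (minkowskiSum l K) ∩ (I₀ : Set (Fin r))) t}

/-- `F` is a saturated Minkowski face on the nontrivial boundary, labeled with `T`: the number of
elements of `T` is the codimension of `F`. -/
def IsSaturated {r : ℕ} (l : Finset (Fin r) → ℕ)
    (𝒟 : Set (Finset (Fin r) → Finset (Fin (r + 1)))) (I₀ : Finset (Fin r))
    (F : Finset (Fin r) → Finset (Fin (r + 1))) (T : Finset (Fin r)) : Prop :=
  IsMinkowskiFace 𝒟 F ∧ OnNontrivialBoundary l (minkowskiSum l F) ∧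
    (T : Set (Fin r)) = faceLabel l 𝒟 I₀ F ∧ dim (minkowskiSum l F) + T.card = r

/-! ### The canonical subdivision -/

/-- The multiplicities of the restriction to the types that precede `I₀`. -/
def before {r : ℕ} (l : Finset (Fin r) → ℕ) (I₀ I : Finset (Fin r)) : ℕ :=
  if Prec I I₀ then l I else 0

/-- One extension step: given a subdivision `𝒟` of the transversalhedron of the types that precede
`I₀`, keep its cells (with the new summand `Δ_{{0}}`) and add the cell `F + l_{I₀} Δ_{{0} ∪ T}` for
each saturated face `F` labeled with `T`. -/
def extend {r : ℕ} (l : Finset (Fin r) → ℕ)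
    (𝒟 : Set (Finset (Fin r) → Finset (Fin (r + 1)))) (I₀ : Finset (Fin r)) :
    Set (Finset (Fin r) → Finset (Fin (r + 1))) :=
  𝒟 ∪ {J | ∃ F T, IsSaturated (before l I₀) 𝒟 I₀ F T ∧ J = Function.update F I₀ (withZero T)}

/-- The single cell of the transversalhedron of the types with at most one element. -/
def initialCell {r : ℕ} (I : Finset (Fin r)) : Finset (Fin (r + 1)) :=
  if I.card ≤ 1 then withZero I else {0}

/-- The occurring types with at least two elements, in increasing order. -/
def laterTypes {r : ℕ} (l : Finset (Fin r) → ℕ) : List (Finset (Fin r)) :=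
  (Finset.univ.filter fun I => 2 ≤ I.card ∧ 0 < l I).sort PrecEq

/-- The canonical subdivision when all singleton types occur: start from the single cell and extend
by the remaining types one after the other. -/
def canonicalOfSingletons {r : ℕ} (l : Finset (Fin r) → ℕ) :
    Set (Finset (Fin r) → Finset (Fin (r + 1))) :=
  (laterTypes l).foldl (extend l) {initialCell}

/-- The multiplicities `l` with one element of type `{i}` added for each singleton type that does
not occur. -/
def fillSingletons {r : ℕ} (l : Finset (Fin r) → ℕ) (I : Finset (Fin r)) : ℕ :=
  if I.card = 1 then max 1 (l I) else l I

/-- The canonical subdivision of the transversalhedron of `l`, as the set of the families `J` that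
describe its cells `∑_I l_I Δ_{J_I}`. If singleton types `{i}` are missing, add them, take the cells
in the region given by `x_i ≥ l_{{i}}` for these `i`, and drop the added summands. -/
def canonicalSubdivision {r : ℕ} (l : Finset (Fin r) → ℕ) :
    Set (Finset (Fin r) → Finset (Fin (r + 1))) :=
  {J | ∃ J' ∈ canonicalOfSingletons (fillSingletons l),
    (∀ i : Fin r, l {i} = 0 →
      ∀ x ∈ minkowskiSum (fillSingletons l) J', (fillSingletons l {i} : ℝ) ≤ x i) ∧
    ∀ I, J I = if l I = 0 then {0} else J' I}

/-- The type `𝓘^a` of the fine cell described by `J`, where `a_I = |J_I| - 1`. -/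
def cellType {r : ℕ} (J : Finset (Fin r) → Finset (Fin (r + 1))) : Multiset (Finset (Fin r)) :=
  collection fun I => (J I).card - 1

end Transversalhedron

open Transversalhedron

/-! Cells of the canonical subdivision are handled by linear algebra: a cell is full-dimensional
and fine, so Hall's condition, tight sets and separations can be read off from dimensions of
spaces of edge directions. -/

namespace Transversalhedron

variable {r : ℕ}

/-! ### Labels, coordinate sums and simplices -/

/-! Give a coordinate set S the weight equal to the number of members of the type of J that lie in
S, and call S tight if its weight is |S|. A cell is fine and full-dimensional, so the members inside
S contribute independent edge directions in the coordinate space of S. This is Hall's condition, and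
S is tight exactly when these directions span that space. Tight sets are closed under intersection,
so I is outside EP exactly when some tight S containing I has only members ⪯ I.

The proof carries two certificates through the construction (`IsGoodCell`). If 0 ∈ J I, there is
such a tight S, hence I ∉ EP. If 0 ∉ J I, there is a set Y with J I inside Y such that no simplex of
a type ⪯ I has labels both in and outside Y. The sum over Y then vanishes on all edges of these
types, so their edges cannot span a coordinate space containing e_j with j ∈ I ∩ Y, and no tight S
as above exists.

In an extension step (`IsGoodCell.update_of_isSaturated`) the labels t ∈ T of the saturated face F
come from hyperplanes of sets H t; let U be their union. Types that meet U use only labels of U in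
F, so U is a separating set for them. A dimension count shows that the complement of U is tight and
that F agrees with its cell on types inside it, so old tight sets may be intersected with this
complement. Finally, in the region cut out for missing singletons each added summand is a point, so
dropping it does not change the type. -/

@[simp] theorem vert_zero : vert (0 : Fin (r + 1)) = 0 := rfl

@[simp] theorem vert_succ (j : Fin r) : vert j.succ = Pi.single j (1 : ℝ) := rfl

/-- The set of positive labels belonging to the elements of `H`. -/
def labels (H : Finset (Fin r)) : Finset (Fin (r + 1)) := H.map (Fin.succEmb r)

@[simp] theorem succ_mem_labels {H : Finset (Fin r)} {j : Fin r} : j.succ ∈ labels H ↔ j ∈ H := by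
  simp [labels]

@[simp] theorem zero_notMem_labels {H : Finset (Fin r)} : (0 : Fin (r + 1)) ∉ labels H := by
  simp [labels]

theorem mem_labels {H : Finset (Fin r)} {v : Fin (r + 1)} :
    v ∈ labels H ↔ ∃ j ∈ H, j.succ = v := by
  simp [labels]

@[simp] theorem zero_mem_withZero {H : Finset (Fin r)} : (0 : Fin (r + 1)) ∈ withZero H := by
  simp [withZero]

@[simp] theorem succ_mem_withZero {H : Finset (Fin r)} {j : Fin r} :
    j.succ ∈ withZero H ↔ j ∈ H := by
  simp [withZero]

theorem card_withZero (H : Finset (Fin r)) : (withZero H).card = H.card + 1 := by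
  rw [withZero, Finset.card_insert_of_notMem (by simp), Finset.card_map]

theorem withZero_mono {H H' : Finset (Fin r)} (h : H ⊆ H') : withZero H ⊆ withZero H' :=
  Finset.insert_subset_insert _ (Finset.map_subset_map.2 h)

@[simp] theorem withZero_empty : withZero (∅ : Finset (Fin r)) = {0} := rfl

/-- The linear functional `y ↦ ∑_{j ∈ H} y_j`. -/
def coordSum (H : Finset (Fin r)) : (Fin r → ℝ) →ₗ[ℝ] ℝ := ∑ j ∈ H, LinearMap.proj j

theorem coordSum_apply (H : Finset (Fin r)) (y : Fin r → ℝ) : coordSum H y = ∑ j ∈ H, y j := by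
  simp [coordSum]

theorem coordSum_single (H : Finset (Fin r)) (j : Fin r) (c : ℝ) :
    coordSum H (Pi.single j c) = if j ∈ H then c else 0 := by
  rw [coordSum_apply]
  simp [Pi.single_apply]

theorem coordSum_vert (H : Finset (Fin r)) (v : Fin (r + 1)) :
    coordSum H (vert v) = if v ∈ labels H then 1 else 0 := by
  induction v using Fin.cases with
  | zero => simp
  | succ j => simp [coordSum_single]

theorem simplex_mono {J J' : Finset (Fin (r + 1))} (h : J ⊆ J') : simplex J ⊆ simplex J' :=
  convexHull_mono (Set.image_mono (by exact_mod_cast h))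

theorem vert_mem_simplex {J : Finset (Fin (r + 1))} {v : Fin (r + 1)} (h : v ∈ J) :
    vert v ∈ simplex J :=
  subset_convexHull _ _ ⟨v, by exact_mod_cast h, rfl⟩

theorem mem_minkowskiSum {l : Finset (Fin r) → ℕ} {J : Finset (Fin r) → Finset (Fin (r + 1))}
    {x : Fin r → ℝ} :
    x ∈ minkowskiSum l J ↔ ∃ g : Finset (Fin r) → (Fin r → ℝ),
      (∀ I, g I ∈ simplex (J I)) ∧ ∑ I, (l I : ℝ) • g I = x := by
  rw [minkowskiSum, Set.mem_fintype_sum]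
  constructor
  · rintro ⟨g, hg, rfl⟩
    choose g' hg' hgg' using fun I => Set.mem_smul_set.1 (hg I)
    exact ⟨g', hg', Finset.sum_congr rfl fun I _ => hgg' I⟩
  · rintro ⟨g, hg, rfl⟩
    exact ⟨_, fun I => Set.smul_mem_smul_set (hg I), rfl⟩

theorem minkowskiSum_mono {l : Finset (Fin r) → ℕ} {J J' : Finset (Fin r) → Finset (Fin (r + 1))}
    (h : ∀ I, J I ⊆ J' I) : minkowskiSum l J ⊆ minkowskiSum l J' := by
  intro x hx
  obtain ⟨g, hg, rfl⟩ := mem_minkowskiSum.1 hx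
  exact mem_minkowskiSum.2 ⟨g, fun I => simplex_mono (h I) (hg I), rfl⟩

theorem convex_minkowskiSum (l : Finset (Fin r) → ℕ) (J : Finset (Fin r) → Finset (Fin (r + 1))) :
    Convex ℝ (minkowskiSum l J) :=
  convex_sum _ fun _ _ => (convex_convexHull ℝ _).smul _

theorem minkowskiSum_nonempty {l : Finset (Fin r) → ℕ}
    {J : Finset (Fin r) → Finset (Fin (r + 1))} (h : ∀ I, (J I).Nonempty) :
    (minkowskiSum l J).Nonempty := by
  choose v hv using h
  exact ⟨_, mem_minkowskiSum.2 ⟨_, fun I => vert_mem_simplex (hv I), rfl⟩⟩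

theorem coordSum_le_of_mem_simplex {I H : Finset (Fin r)} {y : Fin r → ℝ}
    (hy : y ∈ simplex (withZero I)) :
    coordSum H y ≤ if (I ∩ H).Nonempty then 1 else 0 := by
  refine convexHull_min (t := {y | coordSum H y ≤ if (I ∩ H).Nonempty then (1 : ℝ) else 0}) ?_
    (convex_halfSpace_le (coordSum H).isLinear _) hy
  rintro _ ⟨v, hv, rfl⟩
  rw [Set.mem_ofPred_eq, coordSum_vert]
  induction v using Fin.cases with
  | zero => simp only [zero_notMem_labels, if_false]; split_ifs <;> norm_num
  | succ j =>
    have hj : j ∈ I := by simpa using hv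
    by_cases hH : j ∈ H
    · have : (I ∩ H).Nonempty := ⟨j, Finset.mem_inter.2 ⟨hj, hH⟩⟩
      simp [hH, this]
    · simp only [succ_mem_labels, hH, if_false]; split_ifs <;> norm_num

theorem coordSum_le_of_mem_transversalhedron {l : Finset (Fin r) → ℕ} {x : Fin r → ℝ}
    (hx : x ∈ transversalhedron l) (H : Finset (Fin r)) :
    coordSum H x ≤ ∑ I with (I ∩ H).Nonempty, (l I : ℝ) := by
  obtain ⟨g, hg, rfl⟩ := mem_minkowskiSum.1 hx
  rw [map_sum, Finset.sum_filter]
  refine Finset.sum_le_sum fun I _ => ?_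
  rw [map_smul, smul_eq_mul]
  refine (mul_le_mul_of_nonneg_left (coordSum_le_of_mem_simplex (hg I))
    (Nat.cast_nonneg _)).trans ?_
  split_ifs <;> simp

/-- On a face in the hyperplane of `H`, every occurring type that meets `H` only uses labels
from `H`. -/
theorem subset_labels_of_onHyperplane {l : Finset (Fin r) → ℕ}
    {F : Finset (Fin r) → Finset (Fin (r + 1))} (hne : ∀ I, (F I).Nonempty)
    (hsub : ∀ I, F I ⊆ withZero I) {H : Finset (Fin r)}
    (hF : ∀ x ∈ minkowskiSum l F, ∑ j ∈ H, x j = ∑ I with (I ∩ H).Nonempty, (l I : ℝ))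
    {I : Finset (Fin r)} (hI : 0 < l I) (hIH : (I ∩ H).Nonempty) : F I ⊆ labels H := by
  intro v hv
  by_contra hvH
  choose w hw using hne
  -- The vertex using the offending label `v` in the summand of `I` loses there against the maximum
  -- of the coordinate sum, and no other summand can make up for it.
  set u := Function.update w I v with hu
  have hmem : ∀ I', u I' ∈ F I' := by
    intro I'
    rcases eq_or_ne I' I with rfl | h
    · simpa [hu] using hv
    · simpa [hu, h] using hw I'
  have h := hF _ (mem_minkowskiSum.2 ⟨_, fun I' => vert_mem_simplex (hmem I'), rfl⟩)
  rw [← coordSum_apply, map_sum, Finset.sum_filter] at h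
  refine h.not_lt (Finset.sum_lt_sum (fun I' _ => ?_) ⟨I, Finset.mem_univ _, ?_⟩)
  · rw [map_smul, smul_eq_mul]
    refine (mul_le_mul_of_nonneg_left (coordSum_le_of_mem_simplex
      (simplex_mono (hsub I') (vert_mem_simplex (hmem I')))) (Nat.cast_nonneg _)).trans ?_
    split_ifs <;> simp
  · have : u I = v := by simp [hu]
    rw [map_smul, this, coordSum_vert, if_neg hvH, if_pos hIH]
    simpa using hI

/-! ### Edge spaces -/

/-- The direction space of the sum of the simplices `Δ_{F_I}`, `I ∈ D`. -/
def edgeSpace (F : Finset (Fin r) → Finset (Fin (r + 1))) (D : Finset (Finset (Fin r))) :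
    Submodule ℝ (Fin r → ℝ) :=
  D.sup fun I => vectorSpan ℝ (vert '' (F I : Set (Fin (r + 1))))

theorem vectorSpan_simplex (J : Finset (Fin (r + 1))) :
    vectorSpan ℝ (simplex J) = vectorSpan ℝ (vert '' (J : Set (Fin (r + 1)))) := by
  rw [← direction_affineSpan, simplex, affineSpan_convexHull, direction_affineSpan]

theorem vectorSpan_minkowskiSum {l : Finset (Fin r) → ℕ}
    {F : Finset (Fin r) → Finset (Fin (r + 1))} (hne : ∀ I, (F I).Nonempty)
    (hl : ∀ I, F I ≠ {0} → 0 < l I) :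
    vectorSpan ℝ (minkowskiSum l F) = edgeSpace F Finset.univ := by
  apply le_antisymm
  · rw [vectorSpan_def, Submodule.span_le]
    rintro _ ⟨x, hx, y, hy, rfl⟩
    obtain ⟨g, hg, rfl⟩ := mem_minkowskiSum.1 hx
    obtain ⟨g', hg', rfl⟩ := mem_minkowskiSum.1 hy
    simp only [vsub_eq_sub]
    rw [← Finset.sum_sub_distrib]
    refine Submodule.sum_mem _ fun I _ => ?_
    rw [← smul_sub]
    refine Submodule.smul_mem _ _ (Finset.le_sup (f := fun I =>
      vectorSpan ℝ (vert '' (F I : Set (Fin (r + 1))))) (Finset.mem_univ I) ?_)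
    rw [← vectorSpan_simplex]
    exact vsub_mem_vectorSpan ℝ (hg I) (hg' I)
  · refine Finset.sup_le fun I _ => ?_
    by_cases h0 : F I = {0}
    · simp [h0]
    have hI := hl I h0
    rw [vectorSpan_def, Submodule.span_le]
    rintro _ ⟨_, ⟨v, hv, rfl⟩, _, ⟨v', hv', rfl⟩, rfl⟩
    choose w hw using hne
    have key : ∀ u ∈ F I, ∑ I', (l I' : ℝ) • vert (Function.update w I u I') ∈
        minkowskiSum l F := by
      intro u hu
      refine mem_minkowskiSum.2 ⟨_, fun I' => vert_mem_simplex ?_, rfl⟩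
      rcases eq_or_ne I' I with rfl | h
      · simpa using hu
      · simpa [h] using hw I'
    have h := vsub_mem_vectorSpan ℝ (key v hv) (key v' hv')
    have e : (∑ I', (l I' : ℝ) • vert (Function.update w I v I')) -ᵥ
        (∑ I', (l I' : ℝ) • vert (Function.update w I v' I')) =
        (l I : ℝ) • (vert v - vert v') := by
      rw [vsub_eq_sub, ← Finset.sum_sub_distrib, Finset.sum_eq_single I]
      · simp [smul_sub]
      · intro I' _ h
        simp [h]
      · simp
    rw [e] at h
    have h' := Submodule.smul_mem _ (l I : ℝ)⁻¹ h
    rwa [inv_smul_smul₀ (by exact_mod_cast hI.ne')] at h'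

theorem finrank_finset_sup_le {ι : Type*} (D : Finset ι) (V : ι → Submodule ℝ (Fin r → ℝ)) :
    Module.finrank ℝ (D.sup V : Submodule ℝ (Fin r → ℝ)) ≤ ∑ i ∈ D, Module.finrank ℝ (V i) := by
  classical
  induction D using Finset.induction_on with
  | empty => simp
  | insert a s ha ih =>
    rw [Finset.sup_insert, Finset.sum_insert ha]
    exact (Submodule.finrank_add_le_finrank_add_finrank _ _).trans (by gcongr)

theorem edgeSpace_union (F : Finset (Fin r) → Finset (Fin (r + 1)))
    (D D' : Finset (Finset (Fin r))) :
    edgeSpace F (D ∪ D') = edgeSpace F D ⊔ edgeSpace F D' :=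
  Finset.sup_union

theorem finrank_edgeSpace_le {F : Finset (Fin r) → Finset (Fin (r + 1))}
    (hne : ∀ I, (F I).Nonempty) (D : Finset (Finset (Fin r))) :
    Module.finrank ℝ (edgeSpace F D) ≤ ∑ I ∈ D, ((F I).card - 1) := by
  refine (finrank_finset_sup_le D _).trans (Finset.sum_le_sum fun I _ => ?_)
  have := finrank_vectorSpan_image_finset_le ℝ (vert (r := r)) (F I) (n := (F I).card - 1)
    (by have := (hne I).card_pos; omega)
  rwa [Finset.coe_image] at this

/-- If the dimension of the whole sum is as large as possible, so is that of every partial sum. -/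
theorem finrank_edgeSpace_eq {F : Finset (Fin r) → Finset (Fin (r + 1))}
    (hne : ∀ I, (F I).Nonempty)
    (h : ∑ I, ((F I).card - 1) ≤ Module.finrank ℝ (edgeSpace F Finset.univ))
    (D : Finset (Finset (Fin r))) :
    Module.finrank ℝ (edgeSpace F D) = ∑ I ∈ D, ((F I).card - 1) := by
  refine (finrank_edgeSpace_le hne D).antisymm ?_
  have h1 : edgeSpace F Finset.univ = edgeSpace F D ⊔ edgeSpace F Dᶜ := by
    rw [← edgeSpace_union, Finset.union_compl]
  have h2 := Submodule.finrank_add_le_finrank_add_finrank (edgeSpace F D) (edgeSpace F Dᶜ)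
  have h3 := finrank_edgeSpace_le hne Dᶜ
  have h4 := Finset.sum_add_sum_compl D fun I => (F I).card - 1
  rw [h1] at h
  omega

/-- Maximal dimension passes to faces: with a base label chosen in each `F I`, the edges of `J` are
spanned by those of `F` and one further vector for each label in `J I \ F I`. -/
theorem finrank_edgeSpace_face {F J : Finset (Fin r) → Finset (Fin (r + 1))}
    (hne : ∀ I, (F I).Nonempty) (hFJ : ∀ I, F I ⊆ J I)
    (h : ∑ I, ((J I).card - 1) ≤ Module.finrank ℝ (edgeSpace J Finset.univ)) :
    ∑ I, ((F I).card - 1) ≤ Module.finrank ℝ (edgeSpace F Finset.univ) := by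
  classical
  choose w hw using hne
  let B : Finset (Fin r) → Submodule ℝ (Fin r → ℝ) := fun I =>
    Submodule.span ℝ (((J I \ F I).image fun v => vert v - vert (w I) :
      Finset (Fin r → ℝ)) : Set (Fin r → ℝ))
  have h1 : edgeSpace J Finset.univ ≤ edgeSpace F Finset.univ ⊔ Finset.univ.sup B := by
    rw [edgeSpace, edgeSpace, ← Finset.sup_sup]
    refine Finset.sup_mono_fun fun I _ => ?_
    rw [vectorSpan_eq_span_vsub_set_right ℝ (Set.mem_image_of_mem vert (hFJ I (hw I))),
      Submodule.span_le]
    rintro _ ⟨_, ⟨v, hv, rfl⟩, rfl⟩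
    by_cases hvF : v ∈ F I
    · exact Submodule.mem_sup_left (vsub_mem_vectorSpan ℝ ⟨v, hvF, rfl⟩ ⟨w I, hw I, rfl⟩)
    · refine Submodule.mem_sup_right (Submodule.subset_span ?_)
      rw [Finset.coe_image]
      exact ⟨v, by simpa [hvF] using hv, rfl⟩
  have h2 := Submodule.finrank_mono h1
  have h3 := Submodule.finrank_add_le_finrank_add_finrank (edgeSpace F Finset.univ)
    (Finset.univ.sup B)
  have h4 : Module.finrank ℝ (Finset.univ.sup B : Submodule ℝ (Fin r → ℝ)) ≤
      ∑ I, (J I \ F I).card := by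
    refine (finrank_finset_sup_le _ B).trans (Finset.sum_le_sum fun I _ => ?_)
    exact (finrank_span_finset_le_card _).trans Finset.card_image_le
  have h5 : ∑ I, ((J I).card - 1) = ∑ I, ((F I).card - 1) + ∑ I, (J I \ F I).card := by
    rw [← Finset.sum_add_distrib]
    refine Finset.sum_congr rfl fun I _ => ?_
    have := Finset.card_sdiff_add_card_eq_card (hFJ I)
    have := Finset.card_pos.2 ⟨_, hw I⟩
    omega
  omega

/-- The coordinate subspace of `S`. -/
def coordSpace (S : Finset (Fin r)) : Submodule ℝ (Fin r → ℝ) :=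
  Submodule.span ℝ ((fun j => Pi.single j (1 : ℝ)) '' (S : Set (Fin r)))

theorem single_mem_coordSpace {S : Finset (Fin r)} {j : Fin r} (h : j ∈ S) :
    Pi.single j (1 : ℝ) ∈ coordSpace S :=
  Submodule.subset_span ⟨j, h, rfl⟩

theorem finrank_coordSpace (S : Finset (Fin r)) : Module.finrank ℝ (coordSpace S) = S.card := by
  classical
  have hli : LinearIndependent ℝ fun j : S => (Pi.single (j : Fin r) (1 : ℝ) : Fin r → ℝ) := by
    have := (Pi.basisFun ℝ (Fin r)).linearIndependent.comp (fun j : S => (j : Fin r))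
      Subtype.val_injective
    convert this using 2 with j
    simp
  have := finrank_span_eq_card hli
  rw [Fintype.card_coe] at this
  have e : Set.range (fun j : S => (Pi.single (j : Fin r) (1 : ℝ) : Fin r → ℝ)) =
      (fun j => Pi.single j (1 : ℝ)) '' (S : Set (Fin r)) := by
    ext y
    simp
  rw [← this, e, coordSpace]

theorem coordSpace_mono {S S' : Finset (Fin r)} (h : S ⊆ S') : coordSpace S ≤ coordSpace S' :=
  Submodule.span_mono (Set.image_mono (by exact_mod_cast h))

theorem mem_coordSpace_apply {S : Finset (Fin r)} {y : Fin r → ℝ} (hy : y ∈ coordSpace S)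
    {j : Fin r} (hj : j ∉ S) : y j = 0 := by
  have : coordSpace S ≤ LinearMap.ker (LinearMap.proj (R := ℝ) (φ := fun _ : Fin r => ℝ) j) := by
    rw [coordSpace, Submodule.span_le]
    rintro _ ⟨i, hi, rfl⟩
    have hij : j ≠ i := fun h => hj (h ▸ hi)
    simp [hij]
  exact this hy

theorem edgeSpace_le_coordSpace {F : Finset (Fin r) → Finset (Fin (r + 1))}
    {D : Finset (Finset (Fin r))} {S : Finset (Fin r)} (h : ∀ I ∈ D, F I ⊆ withZero S) :
    edgeSpace F D ≤ coordSpace S := by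
  refine Finset.sup_le fun I hI => ?_
  rw [vectorSpan_def, Submodule.span_le]
  have key : ∀ v ∈ F I, vert v ∈ coordSpace S := by
    intro v hv
    have := h I hI hv
    induction v using Fin.cases with
    | zero => simp
    | succ j => exact single_mem_coordSpace (by simpa using this)
  rintro _ ⟨_, ⟨v, hv, rfl⟩, _, ⟨v', hv', rfl⟩, rfl⟩
  exact sub_mem (key v hv) (key v' hv')

/-- The sum over `H` vanishes on the edge space if no simplex has labels both inside and
outside `H`. -/
theorem edgeSpace_le_ker_coordSum {F : Finset (Fin r) → Finset (Fin (r + 1))}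
    {D : Finset (Finset (Fin r))} {H : Finset (Fin r)}
    (h : ∀ I ∈ D, F I ⊆ labels H ∨ Disjoint (F I) (labels H)) :
    edgeSpace F D ≤ LinearMap.ker (coordSum H) := by
  refine Finset.sup_le fun I hI => ?_
  rw [vectorSpan_def, Submodule.span_le]
  rintro _ ⟨_, ⟨v, hv, rfl⟩, _, ⟨v', hv', rfl⟩, rfl⟩
  simp only [vsub_eq_sub, SetLike.mem_coe, LinearMap.mem_ker, map_sub, coordSum_vert]
  rcases h I hI with h | h
  · simp [h hv, h hv']
  · simp [Finset.disjoint_left.1 h hv, Finset.disjoint_left.1 h hv']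

/-! ### Facets on the nontrivial boundary -/

/-- A convex set contains a point from which one can move a little in any given direction of its
direction space. -/
theorem exists_add_smul_mem_of_convex {s : Set (Fin r → ℝ)} (hs : Convex ℝ s) (hne : s.Nonempty)
    {d : Fin r → ℝ} (hd : d ∈ vectorSpan ℝ s) : ∃ x ∈ s, ∃ ε : ℝ, 0 < ε ∧ x + ε • d ∈ s := by
  obtain ⟨x, hx⟩ := hne.intrinsicInterior hs
  obtain ⟨y, hy, rfl⟩ := mem_intrinsicInterior.1 hx
  refine ⟨y, intrinsicInterior_subset hx, ?_⟩
  have hmem : ∀ ε : ℝ, (y : Fin r → ℝ) + ε • d ∈ affineSpan ℝ s := by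
    intro ε
    rw [add_comm]
    refine AffineSubspace.vadd_mem_of_mem_direction (v := ε • d) ?_ y.2
    rw [direction_affineSpan]
    exact Submodule.smul_mem _ _ hd
  let f : ℝ → affineSpan ℝ s := fun ε => ⟨y + ε • d, hmem ε⟩
  have hf : Continuous f := by
    refine Continuous.subtype_mk ?_ _
    fun_prop
  have hf0 : f 0 ∈ interior ((↑) ⁻¹' s : Set (affineSpan ℝ s)) := by
    have : f 0 = y := Subtype.ext (by simp [f])
    rwa [this]
  have hev : ∀ᶠ ε in nhds (0 : ℝ), f ε ∈ interior ((↑) ⁻¹' s : Set (affineSpan ℝ s)) :=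
    hf.continuousAt.eventually (isOpen_interior.mem_nhds hf0)
  obtain ⟨ε, hε, h⟩ := ((hev.filter_mono nhdsWithin_le_nhds).and
    (self_mem_nhdsWithin : Set.Ioi (0 : ℝ) ∈ nhdsWithin 0 (Set.Ioi 0))).exists
  have hεs : f ε ∈ ((↑) ⁻¹' s : Set (affineSpan ℝ s)) := interior_subset hε
  exact ⟨ε, h, hεs⟩

/-- By dimension, the directions of a facet form the whole kernel of the sum over `H`. For j outside
`H` this kernel contains e_j, and a relative interior point can be moved along it; for j in `H` any
such move violates the inequality of `H`. -/
theorem mem_freeDirections_iff {l : Finset (Fin r) → ℕ}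
    {K : Finset (Fin r) → Finset (Fin (r + 1))} (hne : ∀ I, (K I).Nonempty)
    (hsub : ∀ I, K I ⊆ withZero I) (hdim : dim (minkowskiSum l K) + 1 = r)
    {H : Finset (Fin r)} (hH : H.Nonempty)
    (hK : ∀ x ∈ minkowskiSum l K, ∑ j ∈ H, x j = ∑ I with (I ∩ H).Nonempty, (l I : ℝ))
    (j : Fin r) : j ∈ freeDirections l (minkowskiSum l K) ↔ j ∈ H := by
  constructor
  · intro hj
    by_contra hjH
    have hle : vectorSpan ℝ (minkowskiSum l K) ≤ LinearMap.ker (coordSum H) := by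
      rw [vectorSpan_def, Submodule.span_le]
      rintro _ ⟨x, hx, y, hy, rfl⟩
      simp [coordSum_apply, hK x hx, hK y hy]
    have hlt : Module.finrank ℝ (LinearMap.ker (coordSum H)) < r := by
      have h := Submodule.finrank_lt (s := LinearMap.ker (coordSum H)) ?_
      · simpa using h
      · obtain ⟨i, hi⟩ := hH
        intro h
        have : Pi.single i (1 : ℝ) ∈ LinearMap.ker (coordSum H) := h ▸ Submodule.mem_top
        simp [coordSum_single, hi] at this
    have heq := Submodule.eq_of_le_of_finrank_le hle (by rw [dim] at hdim; omega)
    have hd : Pi.single j (1 : ℝ) ∈ vectorSpan ℝ (minkowskiSum l K) := by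
      rw [heq, LinearMap.mem_ker, coordSum_single, if_neg hjH]
    obtain ⟨x, hx, ε, hε, h⟩ := exists_add_smul_mem_of_convex (convex_minkowskiSum l K)
      (minkowskiSum_nonempty hne) hd
    exact hj x hx ε hε (minkowskiSum_mono hsub h)
  · intro hj x hx ε hε h
    have h1 := coordSum_le_of_mem_transversalhedron h H
    rw [← hK x hx, map_add, map_smul, coordSum_single, if_pos hj, coordSum_apply] at h1
    simp only [smul_eq_mul, mul_one] at h1
    linarith

/-- Turns a label into combinatorics: `H` is the set of the hyperplane of the facet, and since its
free directions are exactly `H`, the label is the least element of `H ∩ I₀`. -/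
theorem exists_tight_of_mem_faceLabel {l : Finset (Fin r) → ℕ}
    {𝒟 : Set (Finset (Fin r) → Finset (Fin (r + 1)))}
    (h𝒟 : ∀ J ∈ 𝒟, ∀ I, J I ⊆ withZero I) {I₀ : Finset (Fin r)}
    {F : Finset (Fin r) → Finset (Fin (r + 1))} (hne : ∀ I, (F I).Nonempty)
    (hsub : ∀ I, F I ⊆ withZero I) {t : Fin r} (ht : t ∈ faceLabel l 𝒟 I₀ F) :
    t ∈ I₀ ∧ ∃ H : Finset (Fin r), t ∈ H ∧ (∀ j ∈ H, j ∈ I₀ → t ≤ j) ∧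
      ∀ I, 0 < l I → (I ∩ H).Nonempty → F I ⊆ labels H := by
  obtain ⟨K, ⟨J, hJ, hKJ⟩, hdim, ⟨H, hH, hK⟩, hFK, hleast⟩ := ht
  have hfree := mem_freeDirections_iff (fun I => (hKJ I).1)
    (fun I => (hKJ I).2.trans (h𝒟 J hJ I)) hdim hH hK
  refine ⟨hleast.1.2, H, (hfree t).1 hleast.1.1, fun j hj hj0 => hleast.2 ⟨(hfree j).2 hj, hj0⟩,
    fun I hI hIH => subset_labels_of_onHyperplane hne hsub (fun x hx => hK x (hFK hx)) hI hIH⟩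

/-- Functionals in triangular position with respect to `T` separate the span of `T` from their
common kernel. -/
theorem disjoint_coordSpace {T I₀ : Finset (Fin r)} (hT : T ⊆ I₀) {W : Submodule ℝ (Fin r → ℝ)}
    {H : Fin r → Finset (Fin r)} (hH : ∀ t ∈ T, t ∈ H t ∧ ∀ j ∈ H t, j ∈ I₀ → t ≤ j)
    (hW : ∀ t ∈ T, W ≤ LinearMap.ker (coordSum (H t))) : Disjoint W (coordSpace T) := by
  rw [Submodule.disjoint_def]
  intro y hyW hyT
  by_contra hy
  have hne : (Finset.univ.filter fun j => y j ≠ 0).Nonempty := by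
    obtain ⟨j, hj⟩ := Function.ne_iff.1 hy
    exact ⟨j, by simpa using hj⟩
  -- At the largest support element `t`, any other support element in `H t` would lie in `I₀` and
  -- hence exceed `t`; so the sum over `H t` reduces to `y t`.
  obtain ⟨t, ht, hmax⟩ := Finset.exists_max_image _ id hne
  simp only [Finset.mem_filter, Finset.mem_univ, true_and, id] at ht hmax
  have hsupp : ∀ j, y j ≠ 0 → j ∈ T := fun j hj => by
    by_contra h
    exact hj (mem_coordSpace_apply hyT h)
  have htT := hsupp t ht
  have h0 : coordSum (H t) y = 0 := hW t htT hyW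
  rw [coordSum_apply, Finset.sum_eq_single t] at h0
  · exact ht h0
  · intro j hj hjt
    by_contra hyj
    exact hjt (le_antisymm (hmax j hyj) ((hH t htT).2 j hj (hT (hsupp j hyj))))
  · exact fun h => absurd (hH t htT).1 h

/-! ### Weights of coordinate sets -/

/-- The number of members contained in `S` of the type of the cell described by `J`. -/
def weight (J : Finset (Fin r) → Finset (Fin (r + 1))) (S : Finset (Fin r)) : ℕ :=
  ∑ I with I ⊆ S, ((J I).card - 1)

/-- The cell described by `J` is fine and full-dimensional. -/
structure IsFineCell (J : Finset (Fin r) → Finset (Fin (r + 1))) : Prop where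
  nonempty : ∀ I, (J I).Nonempty
  subset_withZero : ∀ I, J I ⊆ withZero I
  sum_card : ∑ I, ((J I).card - 1) = r
  edgeSpace_eq_top : edgeSpace J Finset.univ = ⊤

namespace IsFineCell

variable {J : Finset (Fin r) → Finset (Fin (r + 1))}

theorem sum_le_finrank (hJ : IsFineCell J) :
    ∑ I, ((J I).card - 1) ≤ Module.finrank ℝ (edgeSpace J Finset.univ) := by
  rw [hJ.edgeSpace_eq_top, hJ.sum_card]
  simp

theorem edgeSpace_le (hJ : IsFineCell J) (S : Finset (Fin r)) :
    edgeSpace J (Finset.univ.filter (· ⊆ S)) ≤ coordSpace S := by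
  refine edgeSpace_le_coordSpace fun I hI => (hJ.subset_withZero I).trans ?_
  exact withZero_mono (by simpa using hI)

theorem finrank_edgeSpace (hJ : IsFineCell J) (S : Finset (Fin r)) :
    Module.finrank ℝ (edgeSpace J (Finset.univ.filter (· ⊆ S))) = weight J S :=
  finrank_edgeSpace_eq hJ.nonempty hJ.sum_le_finrank _

/-- Hall's condition as a comparison of dimensions. -/
theorem weight_le (hJ : IsFineCell J) (S : Finset (Fin r)) : weight J S ≤ S.card := by
  rw [← hJ.finrank_edgeSpace, ← finrank_coordSpace]
  exact Submodule.finrank_mono (hJ.edgeSpace_le S)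

theorem weight_univ (hJ : IsFineCell J) : weight J Finset.univ = r := by
  simpa [weight] using hJ.sum_card

/-- The weight is supermodular and bounded by the cardinality, which is modular. -/
theorem weight_inter (hJ : IsFineCell J) {S S' : Finset (Fin r)} (hS : weight J S = S.card)
    (hS' : weight J S' = S'.card) : weight J (S ∩ S') = (S ∩ S').card := by
  refine (hJ.weight_le _).antisymm ?_
  have h1 : weight J S + weight J S' ≤ weight J (S ∪ S') + weight J (S ∩ S') := by
    simp only [weight, Finset.sum_filter, ← Finset.sum_add_distrib]
    refine Finset.sum_le_sum fun I _ => ?_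
    by_cases h : I ⊆ S <;> by_cases h' : I ⊆ S'
    · simp [h, h', Finset.subset_inter_iff, h.trans Finset.subset_union_left]
    · simp [h, h', Finset.subset_inter_iff, h.trans Finset.subset_union_left]
    · simp [h, h', Finset.subset_inter_iff, h'.trans Finset.subset_union_right]
    · simp [h, h']
  have h2 := hJ.weight_le (S ∪ S')
  have h3 := Finset.card_union_add_card_inter S S'
  omega

end IsFineCell

/-! ### Extending a cell across a saturated face -/

section Face

variable {J F : Finset (Fin r) → Finset (Fin (r + 1))}

theorem finrank_edgeSpace_of_face (hJ : IsFineCell J) (hne : ∀ I, (F I).Nonempty)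
    (hFJ : ∀ I, F I ⊆ J I) (D : Finset (Finset (Fin r))) :
    Module.finrank ℝ (edgeSpace F D) = ∑ I ∈ D, ((F I).card - 1) :=
  finrank_edgeSpace_eq hne (finrank_edgeSpace_face hne hFJ hJ.sum_le_finrank) D

/-- The new summand adds the coordinate directions of `T`; they are independent of the directions of
`F`, and saturation says that together they fill the space. -/
theorem isFineCell_update (hJ : IsFineCell J) (hne : ∀ I, (F I).Nonempty)
    (hFJ : ∀ I, F I ⊆ J I) {I₀ T : Finset (Fin r)} (hF₀ : F I₀ = {0}) (hT : T ⊆ I₀)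
    (hdisj : Disjoint (edgeSpace F Finset.univ) (coordSpace T))
    (hdim : Module.finrank ℝ (edgeSpace F Finset.univ) + T.card = r) :
    IsFineCell (Function.update F I₀ (withZero T)) where
  nonempty I := by
    rcases eq_or_ne I I₀ with rfl | h
    · exact ⟨0, by simp⟩
    · simpa [h] using hne I
  subset_withZero I := by
    rcases eq_or_ne I I₀ with rfl | h
    · simpa using withZero_mono hT
    · simpa [h] using (hFJ I).trans (hJ.subset_withZero I)
  sum_card := by
    rw [finrank_edgeSpace_of_face hJ hne hFJ,
      ← Finset.add_sum_erase _ _ (Finset.mem_univ I₀)] at hdim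
    rw [← Finset.add_sum_erase _ _ (Finset.mem_univ I₀)]
    have : ∑ I ∈ Finset.univ.erase I₀, ((Function.update F I₀ (withZero T) I).card - 1) =
        ∑ I ∈ Finset.univ.erase I₀, ((F I).card - 1) :=
      Finset.sum_congr rfl fun I hI => by simp [Finset.ne_of_mem_erase hI]
    rw [this]
    simp only [hF₀, Finset.card_singleton, Function.update_self, card_withZero] at hdim ⊢
    omega
  edgeSpace_eq_top := by
    have h1 : edgeSpace F Finset.univ ≤
        edgeSpace (Function.update F I₀ (withZero T)) Finset.univ := by
      refine Finset.sup_mono_fun fun I _ => ?_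
      rcases eq_or_ne I I₀ with rfl | h
      · simp [hF₀]
      · simp [h]
    have h2 : coordSpace T ≤ edgeSpace (Function.update F I₀ (withZero T)) Finset.univ := by
      rw [coordSpace, Submodule.span_le]
      rintro _ ⟨t, ht, rfl⟩
      refine Finset.le_sup (f := fun I => vectorSpan ℝ
        (vert '' (Function.update F I₀ (withZero T) I : Set (Fin (r + 1)))))
        (Finset.mem_univ I₀) ?_
      have h0 : (0 : Fin (r + 1)) ∈ withZero T := by simp
      have h' : t.succ ∈ withZero T := by simpa using ht
      have := vsub_mem_vectorSpan ℝ (Set.mem_image_of_mem vert (Finset.mem_coe.2 h'))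
        (Set.mem_image_of_mem vert (Finset.mem_coe.2 h0))
      simpa using this
    apply Submodule.eq_top_of_finrank_eq
    refine (Submodule.finrank_le _).antisymm ?_
    have h4 := Submodule.finrank_mono (sup_le h1 h2)
    have h5 := Submodule.finrank_sup_add_finrank_inf_eq (edgeSpace F Finset.univ) (coordSpace T)
    rw [hdisj.eq_bot, finrank_bot, finrank_coordSpace] at h5
    simp only [Module.finrank_fintype_fun_eq_card, Fintype.card_fin]
    omega

/-- Outside the union `U` of the tight sets, a saturated face agrees with its cell. -/
theorem face_eq_of_subset_compl (hJ : IsFineCell J) (hne : ∀ I, (F I).Nonempty)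
    (hFJ : ∀ I, F I ⊆ J I) {T U : Finset (Fin r)} (hTU : T ⊆ U)
    (hdisj : Disjoint (edgeSpace F Finset.univ) (coordSpace T))
    (hdim : Module.finrank ℝ (edgeSpace F Finset.univ) + T.card = r)
    (hU : ∀ I, F I ≠ {0} → (I ∩ U).Nonempty → F I ⊆ labels U) :
    weight J Uᶜ = Uᶜ.card ∧ ∀ I, I ⊆ Uᶜ → F I = J I := by
  -- The types in `D` meet `U`. Their edges span a subspace of the coordinate space of `U`
  -- independent of that of `T`, so of dimension at most |U| - |T|. Of the total r - |T|, at least r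
  -- - |U| is left to the types inside `Uᶜ`.
  set D := (Finset.univ : Finset (Finset (Fin r))).filter fun I => ¬ I ⊆ Uᶜ with hD
  have h1 : edgeSpace F D ≤ coordSpace U := by
    refine edgeSpace_le_coordSpace fun I hI => ?_
    by_cases h0 : F I = {0}
    · simp [h0]
    · refine (hU I h0 ?_).trans (Finset.subset_insert _ _)
      have : ¬ I ⊆ Uᶜ := by simpa [hD] using hI
      obtain ⟨j, hj, hjU⟩ := Finset.not_subset.1 this
      exact ⟨j, by simpa [hj] using hjU⟩
  have h2 : edgeSpace F D ≤ edgeSpace F Finset.univ := Finset.sup_mono (Finset.subset_univ D)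
  have h3 := Submodule.finrank_mono (sup_le h1 (coordSpace_mono hTU))
  have h4 := Submodule.finrank_sup_add_finrank_inf_eq (edgeSpace F D) (coordSpace T)
  rw [(hdisj.mono_left h2).eq_bot, finrank_bot, finrank_coordSpace,
    finrank_edgeSpace_of_face hJ hne hFJ] at h4
  rw [finrank_coordSpace] at h3
  rw [finrank_edgeSpace_of_face hJ hne hFJ,
    ← Finset.sum_filter_add_sum_filter_not _ (fun I => I ⊆ Uᶜ), ← hD] at hdim
  have h5 : Uᶜ.card ≤ weight F Uᶜ := by
    have := Finset.card_compl_add_card U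
    rw [Fintype.card_fin] at this
    rw [weight]
    omega
  have h6 := hJ.weight_le Uᶜ
  have hle : ∀ I, (F I).card - 1 ≤ (J I).card - 1 := fun I =>
    Nat.sub_le_sub_right (Finset.card_le_card (hFJ I)) 1
  have h7 : weight F Uᶜ ≤ weight J Uᶜ := Finset.sum_le_sum fun I _ => hle I
  refine ⟨by omega, fun I hI => ?_⟩
  -- The chain |Uᶜ| ≤ weight of `F` ≤ weight of `J` ≤ |Uᶜ| collapses, so the two weights agree term
  -- by term.
  have h8 := (Finset.sum_eq_sum_iff_of_le fun I _ => hle I).1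
    (le_antisymm h7 (h6.trans h5)) I (by simpa using hI)
  refine Finset.eq_of_subset_of_card_le (hFJ I) ?_
  have := (hne I).card_pos
  omega

end Face

/-! ### The invariant of the cells -/

/-- The properties of the cells that are preserved by the extension steps. -/
structure IsGoodCell (l : Finset (Fin r) → ℕ) (J : Finset (Fin r) → Finset (Fin (r + 1))) : Prop
    extends IsFineCell J where
  pos_of_ne : ∀ I, J I ≠ {0} → 0 < l I
  -- Needed only for missing singleton types, to identify the summand of an added singleton.
  succ_mem : ∀ j : Fin r, j.succ ∈ J {j}
  -- The certificate for membership in `EP`.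
  exists_separating : ∀ I, 0 ∉ J I → ∃ Y : Finset (Fin r), J I ⊆ labels Y ∧
    ∀ I', PrecEq I' I → J I' ⊆ labels Y ∨ Disjoint (J I') (labels Y)
  -- The certificate for non-membership in `EP`: exchanging a larger member for `I` would overfill
  -- `S`.
  exists_tight : ∀ I, 0 < l I → 0 ∈ J I → ∃ S, I ⊆ S ∧ weight J S = S.card ∧
    ∀ I', I' ⊆ S → 2 ≤ (J I').card → PrecEq I' I

theorem not_prec_iff {I I' : Finset (Fin r)} : ¬ Prec I I' ↔ PrecEq I' I := not_lt

theorem Prec.precEq {I I' : Finset (Fin r)} (h : Prec I I') : PrecEq I I' := le_of_lt h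

theorem Prec.ne {I I' : Finset (Fin r)} (h : Prec I I') : I ≠ I' := by
  rintro rfl
  exact lt_irrefl _ h

theorem prec_of_precEq_of_prec {I I' I'' : Finset (Fin r)} (h : PrecEq I I') (h' : Prec I' I'') :
    Prec I I'' := lt_of_le_of_lt h h'

theorem prec_of_card_lt {I I' : Finset (Fin r)} (h : I.card < I'.card) : Prec I I' :=
  Prod.Lex.toLex_lt_toLex.2 (Or.inl h)

theorem IsGoodCell.update_of_isSaturated {l : Finset (Fin r) → ℕ} (hl : ∀ j, 0 < l {j})
    {𝒟 : Set (Finset (Fin r) → Finset (Fin (r + 1)))} {I₀ : Finset (Fin r)}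
    (hI₀ : 2 ≤ I₀.card) (hlI₀ : 0 < l I₀)
    (h𝒟 : ∀ J ∈ 𝒟, IsGoodCell l J ∧ ∀ I, J I ≠ {0} → Prec I I₀)
    {F : Finset (Fin r) → Finset (Fin (r + 1))} {T : Finset (Fin r)}
    (hFT : IsSaturated (before l I₀) 𝒟 I₀ F T) :
    IsGoodCell l (Function.update F I₀ (withZero T)) ∧
      ∀ I, Function.update F I₀ (withZero T) I ≠ {0} → PrecEq I I₀ := by
  obtain ⟨⟨J, hJ𝒟, hFJ'⟩, -, hTlabel, hdim⟩ := hFT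
  obtain ⟨hJ, hJprec⟩ := h𝒟 J hJ𝒟
  have hne : ∀ I, (F I).Nonempty := fun I => (hFJ' I).1
  have hFJ : ∀ I, F I ⊆ J I := fun I => (hFJ' I).2
  have hsub : ∀ I, F I ⊆ withZero I := fun I => (hFJ I).trans (hJ.subset_withZero I)
  have hF0 : ∀ I, J I = {0} → F I = {0} := fun I h =>
    (Finset.subset_singleton_iff.1 (h ▸ hFJ I)).resolve_left (hne I).ne_empty
  have hFprec : ∀ I, F I ≠ {0} → Prec I I₀ := fun I h => hJprec I fun h' => h (hF0 I h')
  have hFpos : ∀ I, F I ≠ {0} → 0 < l I := fun I h => hJ.pos_of_ne I fun h' => h (hF0 I h')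
  have hbefore : ∀ I, Prec I I₀ → before l I₀ I = l I := fun I h => if_pos h
  have hF₀ : F I₀ = {0} := by
    by_contra h
    exact (hFprec I₀ h).ne rfl
  rw [dim, vectorSpan_minkowskiSum hne fun I h => by
    rw [hbefore I (hFprec I h)]
    exact hFpos I h] at hdim
  have htight := fun t (ht : t ∈ T) => exists_tight_of_mem_faceLabel (l := before l I₀)
    (fun J hJ => (h𝒟 J hJ).1.subset_withZero) hne hsub
    (show t ∈ faceLabel (before l I₀) 𝒟 I₀ F from hTlabel ▸ ht)
  have hT : T ⊆ I₀ := fun t ht => (htight t ht).1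
  choose! H hH using fun t (ht : t ∈ T) => (htight t ht).2
  have hker : ∀ S : Finset (Fin r),
      (∀ I, 0 < before l I₀ I → (I ∩ S).Nonempty → F I ⊆ labels S) →
      ∀ I, F I ⊆ labels S ∨ Disjoint (F I) (labels S) := by
    intro S hS I
    by_cases h0 : F I = {0}
    · right
      simp [h0]
    by_cases hIS : (I ∩ S).Nonempty
    · exact Or.inl (hS I (by rw [hbefore I (hFprec I h0)]; exact hFpos I h0) hIS)
    · right
      rw [Finset.disjoint_left]
      intro v hv hvS
      obtain ⟨j, hj, rfl⟩ := mem_labels.1 hvS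
      exact hIS ⟨j, Finset.mem_inter.2 ⟨by simpa using hsub I hv, hj⟩⟩
  have hdisj : Disjoint (edgeSpace F Finset.univ) (coordSpace T) :=
    disjoint_coordSpace hT (fun t ht => ⟨(hH t ht).1, (hH t ht).2.1⟩) fun t ht =>
      edgeSpace_le_ker_coordSum fun I _ => hker (H t) (hH t ht).2.2 I
  have hfine := isFineCell_update hJ.toIsFineCell hne hFJ hF₀ hT hdisj hdim
  set U := T.biUnion H with hUdef
  have hTU : T ⊆ U := fun t ht => Finset.mem_biUnion.2 ⟨t, ht, (hH t ht).1⟩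
  have hU : ∀ I, 0 < before l I₀ I → (I ∩ U).Nonempty → F I ⊆ labels U := by
    rintro I hI ⟨j, hj⟩
    obtain ⟨hjI, hjU⟩ := Finset.mem_inter.1 hj
    obtain ⟨t, ht, hjt⟩ := Finset.mem_biUnion.1 hjU
    exact ((hH t ht).2.2 I hI ⟨j, Finset.mem_inter.2 ⟨hjI, hjt⟩⟩).trans
      (Finset.map_subset_map.2 (Finset.subset_biUnion_of_mem H ht))
  obtain ⟨hZ, hFZ⟩ := face_eq_of_subset_compl hJ.toIsFineCell hne hFJ hTU hdisj hdim
    fun I h => hU I (by rw [hbefore I (hFprec I h)]; exact hFpos I h)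
  have hcases : ∀ I, Prec I I₀ → 0 < l I → F I = J I ∧ I ⊆ Uᶜ ∨ F I ⊆ labels U := by
    intro I hI hlI
    by_cases h : I ⊆ Uᶜ
    · exact Or.inl ⟨hFZ I h, h⟩
    · obtain ⟨j, hj, hjU⟩ := Finset.not_subset.1 h
      exact Or.inr (hU I (by rwa [hbefore I hI]) ⟨j, by simpa [hj] using hjU⟩)
  set N := Function.update F I₀ (withZero T) with hN
  have hN₀ : N I₀ = withZero T := by simp [hN]
  have hNne : ∀ I, I ≠ I₀ → N I = F I := fun I h => by simp [hN, h]
  have hNprec : ∀ I, N I ≠ {0} → PrecEq I I₀ := by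
    intro I h
    rcases eq_or_ne I I₀ with rfl | hI
    · exact le_refl _
    · exact (hFprec I (hNne I hI ▸ h)).precEq
  refine ⟨⟨hfine, fun I h => ?_, fun j => ?_, fun I h => ?_, fun I hlI h => ?_⟩, hNprec⟩
  · rcases eq_or_ne I I₀ with rfl | hI
    · exact hlI₀
    · exact hFpos I (hNne I hI ▸ h)
  · have hj : Prec {j} I₀ := prec_of_card_lt (by rw [Finset.card_singleton]; omega)
    rw [hNne _ hj.ne]
    rcases hcases {j} hj (hl j) with h | h
    · rw [h.1]
      exact hJ.succ_mem j
    -- If j lies in `U`, the face has lost the label 0 at `{j}`, and the label of j is the only one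
    -- left.
    · obtain ⟨v, hv⟩ := hne {j}
      obtain ⟨i, -, rfl⟩ := mem_labels.1 (h hv)
      have : i = j := by simpa using hsub {j} hv
      rwa [← this] at hv ⊢
  · have hI : I ≠ I₀ := by
      rintro rfl
      simp [hN₀] at h
    rw [hNne I hI] at h ⊢
    have hF : F I ≠ {0} := fun h' => by simp [h'] at h
    have hIprec := hFprec I hF
    have hN' : ∀ I', PrecEq I' I → N I' = F I' := fun I' h' =>
      hNne I' (prec_of_precEq_of_prec h' hIprec).ne
    -- If 0 was lost in passing to the face, `F I` differs from `J I`, so `I` meets `U` and `U`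
    -- separates. Otherwise the separating set of `J` still works, since labels have only been
    -- removed.
    by_cases h0 : 0 ∈ J I
    · rcases hcases I hIprec (hFpos I hF) with h' | h'
      · exact absurd (h'.1 ▸ h0) h
      · exact ⟨U, h', fun I' hI' => by
          rw [hN' I' hI']
          exact hker U hU I'⟩
    · obtain ⟨Y, hY, hYsep⟩ := hJ.exists_separating I h0
      refine ⟨Y, (hFJ I).trans hY, fun I' hI' => ?_⟩
      rw [hN' I' hI']
      exact (hYsep I' hI').imp (hFJ I').trans fun h => h.mono_left (hFJ I')
  · by_cases hI : Prec I I₀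
    · rw [hNne I hI.ne] at h
      have hIU : I ⊆ Uᶜ := by
        rcases hcases I hI hlI with h' | h'
        · exact h'.2
        · exact absurd (h' h) zero_notMem_labels
      obtain ⟨S, hIS, hS, hSprec⟩ := hJ.exists_tight I hlI (hFJ I h)
      have hNJ : ∀ I', I' ⊆ Uᶜ → N I' = J I' := by
        intro I' hI'
        -- If `I₀` itself lies in `Uᶜ`, then `T` lies in both `U` and `Uᶜ`, so the new summand is
        -- trivial.
        rcases eq_or_ne I' I₀ with rfl | hne'
        · have : T = ∅ := Finset.eq_empty_of_forall_notMem fun t ht =>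
            Finset.mem_compl.1 (hI' (hT ht)) (hTU ht)
          rw [hN₀, this, withZero_empty, ← hFZ _ hI', hF₀]
        · rw [hNne I' hne', hFZ I' hI']
      refine ⟨S ∩ Uᶜ, Finset.subset_inter hIS hIU, ?_, fun I' hI' h2 => ?_⟩
      · rw [← hJ.weight_inter hS hZ]
        refine Finset.sum_congr rfl fun I' hI' => ?_
        have : I' ⊆ S ∩ Uᶜ := by simpa using hI'
        rw [hNJ I' (this.trans Finset.inter_subset_right)]
      · rw [hNJ I' (hI'.trans Finset.inter_subset_right)] at h2
        exact hSprec I' (hI'.trans Finset.inter_subset_left) h2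
    -- From `I₀` on, the whole of `[r]` serves as tight set, as every member is ⪯ `I₀`.
    · refine ⟨Finset.univ, Finset.subset_univ I, by simpa using hfine.weight_univ, ?_⟩
      refine fun I' _ h' => le_trans (hNprec I' fun h0 => ?_) (not_prec_iff.1 hI)
      simp [h0] at h'

/-- The members are the singletons, once each, so every set is tight; every simplex contains 0, so
no separating set is asked for. -/
theorem isGoodCell_initialCell {l : Finset (Fin r) → ℕ} (hl : ∀ j, 0 < l {j}) :
    IsGoodCell l (initialCell (r := r)) := by
  have hcard : ∀ I : Finset (Fin r), (initialCell I).card - 1 = if I.card = 1 then 1 else 0 := by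
    intro I
    unfold initialCell
    split_ifs with h1 h2 h2
    · simp [card_withZero, h2]
    · have : I.card = 0 := by omega
      simp [card_withZero, this]
    · omega
    · simp
  have hweight : ∀ S : Finset (Fin r), weight initialCell S = S.card := by
    intro S
    simp only [weight, hcard, Finset.sum_boole, Nat.cast_id]
    rw [Finset.filter_filter, ← Finset.card_map (s := S) ⟨_, Finset.singleton_injective⟩]
    refine congrArg Finset.card (Finset.ext fun I => ?_)
    simp only [Finset.mem_filter, Finset.mem_univ, true_and, Finset.mem_map,
      Function.Embedding.coeFn_mk, Finset.card_eq_one]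
    constructor
    · rintro ⟨h, j, rfl⟩
      exact ⟨j, by simpa using h, rfl⟩
    · rintro ⟨j, hj, rfl⟩
      exact ⟨by simpa using hj, j, rfl⟩
  have hzero : ∀ I : Finset (Fin r), 0 ∈ initialCell I := by
    intro I
    unfold initialCell
    split_ifs <;> simp
  refine ⟨⟨fun I => ⟨0, hzero I⟩, fun I => ?_, ?_, ?_⟩, fun I h => ?_, fun j => ?_,
    fun I h => absurd (hzero I) h, fun I _ _ => ?_⟩
  · unfold initialCell
    split_ifs <;> simp
  · simpa [weight] using hweight Finset.univ
  · rw [eq_top_iff, ← (Pi.basisFun ℝ (Fin r)).span_eq, Submodule.span_le]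
    rintro _ ⟨j, rfl⟩
    refine Finset.le_sup (f := fun I => vectorSpan ℝ
      (vert '' (initialCell I : Set (Fin (r + 1))))) (Finset.mem_univ {j}) ?_
    have h' : j.succ ∈ initialCell {j} := by simp [initialCell]
    have := vsub_mem_vectorSpan ℝ (Set.mem_image_of_mem vert (Finset.mem_coe.2 h'))
      (Set.mem_image_of_mem vert (Finset.mem_coe.2 (hzero {j})))
    simpa using this
  · unfold initialCell at h
    split_ifs at h with h1
    · rcases Nat.le_one_iff_eq_zero_or_eq_one.1 h1 with h0 | h0
      · simp [Finset.card_eq_zero.1 h0] at h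
      · obtain ⟨j, rfl⟩ := Finset.card_eq_one.1 h0
        exact hl j
    · exact absurd rfl h
  · simp [initialCell]
  · by_cases hI : I.card ≤ 1
    · refine ⟨I, subset_rfl, hweight I, fun I' hI' h => ?_⟩
      have h1 := hcard I'
      split_ifs at h1 with h2
      · rw [Finset.eq_of_subset_of_card_le hI' (by omega)]
        exact le_refl _
      · omega
    · refine ⟨Finset.univ, Finset.subset_univ _, hweight _, fun I' _ h => ?_⟩
      have h1 := hcard I'
      split_ifs at h1 with h2
      · exact (prec_of_card_lt (by omega)).precEq
      · omega

/-- The induction also carries that every nontrivial summand belongs to a type preceding all those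
still to be treated. -/
theorem isGoodCell_of_mem_foldl {l : Finset (Fin r) → ℕ} (hl : ∀ j, 0 < l {j})
    (L : List (Finset (Fin r))) (hL : L.Pairwise Prec) (hL' : ∀ I ∈ L, 2 ≤ I.card ∧ 0 < l I)
    {𝒟 : Set (Finset (Fin r) → Finset (Fin (r + 1)))}
    (h𝒟 : ∀ J ∈ 𝒟, IsGoodCell l J ∧ ∀ I, J I ≠ {0} → ∀ I₀ ∈ L, Prec I I₀)
    {J : Finset (Fin r) → Finset (Fin (r + 1))} (hJ : J ∈ L.foldl (extend l) 𝒟) :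
    IsGoodCell l J := by
  induction L generalizing 𝒟 with
  | nil => exact (h𝒟 J hJ).1
  | cons I₀ L ih =>
    rw [List.pairwise_cons] at hL
    refine ih hL.2 (fun I hI => hL' I (List.mem_cons_of_mem _ hI)) ?_ hJ
    rintro N (hN | ⟨F, T, hFT, rfl⟩)
    · exact ⟨(h𝒟 N hN).1, fun I h I₁ hI₁ => (h𝒟 N hN).2 I h I₁ (List.mem_cons_of_mem _ hI₁)⟩
    · obtain ⟨hc, hp⟩ := hL' I₀ List.mem_cons_self
      obtain ⟨h1, h2⟩ := IsGoodCell.update_of_isSaturated hl hc hp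
        (fun J hJ => ⟨(h𝒟 J hJ).1, fun I h => (h𝒟 J hJ).2 I h I₀ List.mem_cons_self⟩) hFT
      exact ⟨h1, fun I h I₁ hI₁ => prec_of_precEq_of_prec (h2 I h) (hL.1 I₁ hI₁)⟩

theorem isGoodCell_of_mem_canonicalOfSingletons {l : Finset (Fin r) → ℕ} (hl : ∀ j, 0 < l {j})
    {J : Finset (Fin r) → Finset (Fin (r + 1))} (hJ : J ∈ canonicalOfSingletons l) :
    IsGoodCell l J := by
  have hmem : ∀ I ∈ laterTypes l, 2 ≤ I.card ∧ 0 < l I := by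
    intro I hI
    simpa [laterTypes] using hI
  refine isGoodCell_of_mem_foldl hl (laterTypes l) ?_ hmem ?_ hJ
  · have h1 : (laterTypes l).Pairwise PrecEq := Finset.pairwise_sort _ _
    have h2 : (laterTypes l).Nodup := Finset.sort_nodup _ _
    exact h1.imp₂ (fun I I' h h' => lt_of_le_of_ne h fun e => h' (precKey_injective e)) h2
  · rintro J rfl
    refine ⟨isGoodCell_initialCell hl, fun I h I₀ hI₀ => prec_of_card_lt ?_⟩
    have := (hmem I₀ hI₀).1
    unfold initialCell at h
    split_ifs at h with h1
    · omega
    · exact absurd rfl h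

/-! ### Exchanges in maximal valid collections -/

/-- For a fixed union it is enough to test the subcollection of all members contained in it. -/
theorem isValid_iff {τ : Multiset (Finset (Fin r))} :
    IsValid τ ↔ ∀ S : Finset (Fin r), τ.countP (· ⊆ S) ≤ S.card := by
  constructor
  · intro h S
    rw [Multiset.countP_eq_card_filter]
    refine (h _ (Multiset.filter_le _ _)).trans (Finset.card_le_card ?_)
    exact Multiset.sup_le.2 fun I hI => (Multiset.mem_filter.1 hI).2
  · intro h s hs
    refine le_trans ?_ (h s.sup)
    refine le_trans (le_of_eq ?_) (Multiset.countP_le_of_le _ hs)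
    exact (Multiset.countP_eq_card.2 fun I hI => Multiset.le_sup hI).symm

theorem countP_cellType (J : Finset (Fin r) → Finset (Fin (r + 1))) (S : Finset (Fin r)) :
    (cellType J).countP (· ⊆ S) = weight J S := by
  rw [cellType, collection, weight, Finset.sum_filter, ← Multiset.coe_countPAddMonoidHom, map_sum]
  refine Finset.sum_congr rfl fun I _ => ?_
  rw [Multiset.coe_countPAddMonoidHom, ← Multiset.coe_replicate, Multiset.coe_countP,
    List.countP_replicate]
  simp

theorem mem_cellType {J : Finset (Fin r) → Finset (Fin (r + 1))} {I : Finset (Fin r)} :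
    I ∈ cellType J ↔ 2 ≤ (J I).card := by
  rw [cellType, collection, Multiset.mem_sum]
  simp only [Finset.mem_univ, true_and, Multiset.mem_replicate]
  constructor
  · rintro ⟨I', h, rfl⟩
    omega
  · exact fun h => ⟨I, by omega, rfl⟩

theorem card_cellType (J : Finset (Fin r) → Finset (Fin (r + 1))) :
    Multiset.card (cellType J) = ∑ I, ((J I).card - 1) := by
  simp [cellType, collection]

theorem countP_cons_erase {τ : Multiset (Finset (Fin r))} {I I' : Finset (Fin r)} (h : I' ∈ τ)
    (S : Finset (Fin r)) :
    (I ::ₘ τ.erase I').countP (· ⊆ S) + (if I' ⊆ S then 1 else 0) =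
      τ.countP (· ⊆ S) + if I ⊆ S then 1 else 0 := by
  conv_rhs => rw [← Multiset.cons_erase h]
  rw [Multiset.countP_cons, Multiset.countP_cons]
  ring

theorem IsFineCell.card_cellType {J : Finset (Fin r) → Finset (Fin (r + 1))} (hJ : IsFineCell J) :
    Multiset.card (cellType J) = r := by
  rw [Transversalhedron.card_cellType, hJ.sum_card]

/-- If `I` cannot replace any larger member, then it lies in a tight set without larger
members. -/
theorem IsFineCell.exists_tight_of_notMem_EP {J : Finset (Fin r) → Finset (Fin (r + 1))}
    (hJ : IsFineCell J) {I : Finset (Fin r)} (hI : I ∉ EP (cellType J)) :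
    ∃ S, I ⊆ S ∧ weight J S = S.card ∧ ∀ I', I' ⊆ S → 2 ≤ (J I').card → PrecEq I' I := by
  -- The intersection of `𝒮` is the least tight set containing `I`; the members that `I` can replace
  -- include all those inside it.
  let 𝒮 := (Finset.univ : Finset (Finset (Fin r))).filter
    fun S => I ⊆ S ∧ weight J S = S.card
  have hinf : I ⊆ 𝒮.inf id ∧ weight J (𝒮.inf id) = (𝒮.inf id).card := by
    refine Finset.inf_induction (p := fun S => I ⊆ S ∧ weight J S = S.card) ?_ ?_ ?_
    · exact ⟨Finset.subset_univ _, by simpa using hJ.weight_univ⟩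
    · exact fun S hS S' hS' => ⟨Finset.subset_inter hS.1 hS'.1, hJ.weight_inter hS.2 hS'.2⟩
    · exact fun S hS => (Finset.mem_filter.1 hS).2
  refine ⟨𝒮.inf id, hinf.1, hinf.2, fun I' hI' hcard => ?_⟩
  by_contra hprec
  have hmem := mem_cellType.2 hcard
  refine hI ⟨I', lt_of_not_ge hprec, isValid_iff.2 fun S => ?_, ?_⟩
  -- A set violating Hall's condition after the exchange must be tight and contain `I` but not `I'`.
  -- Yet it contains the least tight set around `I`, hence `I'`.
  · by_contra! hlt
    have h1 := countP_cons_erase (I := I) hmem S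
    rw [countP_cellType] at h1
    have h2 := hJ.weight_le S
    split_ifs at h1 with h3 h4 h4
    · omega
    · omega
    · refine h3 (hI'.trans ?_)
      exact Finset.inf_le (f := id) (Finset.mem_filter.2 ⟨Finset.mem_univ S, h4, by omega⟩)
    · omega
  · rw [Multiset.card_cons, Multiset.card_erase_add_one hmem, hJ.card_cellType]

theorem IsGoodCell.zero_notMem_iff {l : Finset (Fin r) → ℕ}
    {J : Finset (Fin r) → Finset (Fin (r + 1))} (hJ : IsGoodCell l J) {I : Finset (Fin r)}
    (hI : 0 < l I) : 0 ∉ J I ↔ I ∈ EP (cellType J) := by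
  constructor
  · intro h0
    by_contra hEP
    obtain ⟨S, hIS, hS, hprec⟩ := hJ.exists_tight_of_notMem_EP hEP
    obtain ⟨Y, hY, hsep⟩ := hJ.exists_separating I h0
    have heq : edgeSpace J (Finset.univ.filter (· ⊆ S)) = coordSpace S :=
      Submodule.eq_of_le_of_finrank_le (hJ.edgeSpace_le S)
        (by rw [hJ.finrank_edgeSpace, finrank_coordSpace, hS])
    -- Members inside `S` are ⪯ `I` and so are separated by `Y`; the remaining simplices are single
    -- points and have no edges.
    have hker : edgeSpace J (Finset.univ.filter (· ⊆ S)) ≤ LinearMap.ker (coordSum Y) := by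
      refine edgeSpace_le_ker_coordSum fun I' hI' => ?_
      by_cases h2 : 2 ≤ (J I').card
      · exact hsep I' (hprec I' (by simpa using hI') h2)
      · obtain ⟨v, hv⟩ := Finset.card_eq_one.1
          (le_antisymm (by omega) (hJ.nonempty I').card_pos)
        by_cases hvY : v ∈ labels Y <;> simp [hv, hvY]
    obtain ⟨v, hv⟩ := hJ.nonempty I
    obtain ⟨j, hj, rfl⟩ := mem_labels.1 (hY hv)
    have hjI : j ∈ I := by simpa using hJ.subset_withZero I hv
    have := hker (heq ▸ single_mem_coordSpace (hIS hjI))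
    simp [coordSum_single, hj] at this
  · rintro ⟨I', hII', hvalid, hcard⟩ h0
    -- If `I'` did not occur, nothing would be erased and the collection would have r + 1 members.
    have hmem : I' ∈ cellType J := by
      by_contra h
      rw [Multiset.erase_of_notMem h, Multiset.card_cons, hJ.card_cellType] at hcard
      omega
    obtain ⟨S, hIS, hS, hprec⟩ := hJ.exists_tight I hI h0
    have hI'S : ¬ I' ⊆ S := fun h =>
      not_prec_iff.2 (hprec I' h (mem_cellType.1 hmem)) hII'
    have h1 := countP_cons_erase (I := I) hmem S
    have h2 := isValid_iff.1 hvalid S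
    rw [countP_cellType, if_neg hI'S, if_pos hIS] at h1
    omega

/-! ### Missing singleton types -/

/-- If 0 were in `J {i}`, a vertex avoiding the label of i wherever possible would have i-th
coordinate 0, unless another type is confined to that label. A set separating for that type contains
i and would split `J {i}`, which has both 0 and the label of i. -/
theorem IsGoodCell.eq_singleton_of_le {l : Finset (Fin r) → ℕ}
    {J : Finset (Fin r) → Finset (Fin (r + 1))} (hJ : IsGoodCell l J) {i : Fin r}
    (hi : 0 < l {i}) (h : ∀ x ∈ minkowskiSum l J, (l {i} : ℝ) ≤ x i) : J {i} = {i.succ} := by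
  have h0 : 0 ∉ J {i} := by
    intro h0
    have hv : ∀ I, ∃ v ∈ J I, (I = {i} → v = 0) ∧ (I ≠ {i} → J I ≠ {i.succ} → v ≠ i.succ) := by
      intro I
      by_cases hI : I = {i}
      · exact ⟨0, hI ▸ h0, fun _ => rfl, fun h => absurd hI h⟩
      by_cases hI' : J I = {i.succ}
      · exact ⟨i.succ, by simp [hI'], fun h => absurd h hI, fun _ h => absurd hI' h⟩
      · obtain ⟨v, hv, hvi⟩ : ∃ v ∈ J I, v ≠ i.succ := by
          by_contra! hall
          exact hI' (Finset.eq_singleton_iff_nonempty_unique_mem.2 ⟨hJ.nonempty I, hall⟩)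
        exact ⟨v, hv, fun h => absurd h hI, fun _ _ => hvi⟩
    choose v hv hv0 hvi using hv
    have hx := h _ (mem_minkowskiSum.2 ⟨_, fun I => vert_mem_simplex (hv I), rfl⟩)
    obtain ⟨I, hI, hJI⟩ : ∃ I, I ≠ {i} ∧ J I = {i.succ} := by
      by_contra! hall
      have hz : (∑ I, (l I : ℝ) • vert (v I)) i = 0 := by
        rw [Finset.sum_apply]
        refine Finset.sum_eq_zero fun I _ => ?_
        have hne : v I ≠ i.succ := by
          by_cases hI : I = {i}
          · rw [hv0 I hI]
            exact (Fin.succ_ne_zero i).symm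
          · exact hvi I hI (hall I hI)
        have : vert (v I) i = 0 := by
          generalize v I = u at hne
          induction u using Fin.cases with
          | zero => simp
          | succ j =>
            have : i ≠ j := fun h => hne (h ▸ rfl)
            simp [this]
        simp [this]
      rw [hz] at hx
      exact absurd hx (by simpa using hi.ne')
    have hiI : i ∈ I := by
      have := hJ.subset_withZero I (hJI ▸ Finset.mem_singleton_self i.succ)
      simpa using this
    have hprec : PrecEq {i} I := by
      refine (prec_of_card_lt ?_).precEq
      exact Finset.card_lt_card
        ((Finset.singleton_subset_iff.2 hiI).ssubset_of_ne (Ne.symm hI))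
    obtain ⟨Y, hY, hsep⟩ := hJ.exists_separating I (by simpa [hJI] using (Fin.succ_ne_zero i).symm)
    have hiY : i.succ ∈ labels Y := hY (by simp [hJI])
    rcases hsep {i} hprec with h' | h'
    · exact zero_notMem_labels (h' h0)
    · exact Finset.disjoint_left.1 h' (hJ.succ_mem i) hiY
  refine Finset.eq_singleton_iff_unique_mem.2 ⟨hJ.succ_mem i, fun v hv => ?_⟩
  have := hJ.subset_withZero {i} hv
  induction v using Fin.cases with
  | zero => exact absurd hv h0
  | succ j => rw [Finset.mem_singleton.1 (succ_mem_withZero.1 this)]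

theorem fillSingletons_singleton_pos (l : Finset (Fin r) → ℕ) (j : Fin r) :
    0 < fillSingletons l {j} := by
  simp [fillSingletons]

theorem le_fillSingletons (l : Finset (Fin r) → ℕ) (I : Finset (Fin r)) :
    l I ≤ fillSingletons l I := by
  unfold fillSingletons
  split_ifs <;> simp

/-- A dropped summand is either already `{0}` or belongs to an added singleton, where the region
forces a one-point simplex. Replacing it by `{0}` keeps the multiplicity 0 in the type. -/
theorem zero_notMem_iff_of_mem_canonicalSubdivision {l : Finset (Fin r) → ℕ}
    {J : Finset (Fin r) → Finset (Fin (r + 1))} (hJ : J ∈ canonicalSubdivision l)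
    {I : Finset (Fin r)} (hI : 0 < l I) : 0 ∉ J I ↔ I ∈ EP (cellType J) := by
  obtain ⟨J', hJ', hregion, hJJ'⟩ := hJ
  have hgood := isGoodCell_of_mem_canonicalOfSingletons (fillSingletons_singleton_pos l) hJ'
  have htype : cellType J = cellType J' := by
    unfold cellType
    congr 1
    ext I'
    rw [hJJ' I']
    split_ifs with h0
    · by_cases h : J' I' = {0}
      · rw [h]
      have hpos := hgood.pos_of_ne I' h
      have hcard : I'.card = 1 := by
        by_contra hc
        simp [fillSingletons, hc, h0] at hpos
      obtain ⟨i, rfl⟩ := Finset.card_eq_one.1 hcard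
      rw [hgood.eq_singleton_of_le hpos (hregion i h0)]
      rfl
    · rfl
  rw [htype, hJJ' I, if_neg hI.ne']
  exact hgood.zero_notMem_iff (hI.trans_le (le_fillSingletons l I))

end Transversalhedron

theorem mainTheorem5 {n r : ℕ} (M : Matroid (Fin n)) (A : Fin r → Finset (Fin n))
    (hA : IsPresentation M A) (hr : M.eRank = r)
    (J : Finset (Fin r) → Finset (Fin (r + 1)))
    (hJ : J ∈ canonicalSubdivision (mult A))
    (I : Finset (Fin r)) (hI : 0 < mult A I) :
    0 ∉ J I ↔ I ∈ EP (cellType J) := by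
  exact zero_notMem_iff_of_mem_canonicalSubdivision hJ hI
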